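/- Let $A$ be a separable $C^*$-algebra, not necessarily unital, with multiplier algebra $M(A)$. Every bounded functional $\psi$ on $A$ is extended canonically to $M(A)$ by $\psi(m)=\lim_\lambda\psi(me_\lambda)$, where $(e_\lambda)$ is an increasing approximate unit of $A$. Let $T$ be a locally compact metric space and $\mu$ a Borel probability measure on $T$. A field $(m_t)_{t\in T}$ in $M(A)$ is weak* measurable if $t\mapsto\psi(m_t)$ is $\mu$-measurable for every $\psi\in A^*$; an element $z\in M(A)$ is its integral, $z=\int_T m_t\,d\mu(t)$, if for every $\psi\in A^*$ the function $t\mapsto\psi(m_t)$ is $\mu$-integrable with $\int_T\psi(m_t)\,d\mu(t)=\psi(z)$. For commuting self-adjoint elements $x_1,\dots,x_n$ of $A$ and a real function $f$ that is continuous on the product of their spectra (taken in $M(A)$), $f(x_1,\dots,x_n)\in M(A)$ is given by the joint continuous functional calculus. The centralizer of a positive functional $\varphi$ on $A$ is $\{y\in A:\varphi(xy)=\varphi(yx)\text{ for all }x\in A\}$. Let $I_1,\dots,I_n\subseteq\mathbb R$ be intervals and let $f\colon I_1\times\cdots\times I_n\to\mathbb R$ be convex and continuous. For $1\le i\le n$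 let $(x_{it})_{t\in T}$ be a bounded, weak* measurable field of self-adjoint elements of $A$ with spectra contained in $I_i$, and assume that $$[x_{it},x_{js}]=[x_{jt},x_{is}]\qquad\text{for all } i,j,s,t.$$ Write $\mathbf x_t=(x_{1t},\dots,x_{nt})$. Then the integrals $y_i=\int_T x_{it}\,d\mu(t)$ exist in $A$, are self-adjoint with spectra contained in $I_i$, and commute with each other. The field $(f(\mathbf x_t))_{t\in T}$ in $M(A)$ is weak* measurable, and it has an integral in $M(A)$ if all $I_i$ are closed or if $t\mapsto\|f(\mathbf x_t)\|$ is $\mu$-integrable. Whenever $\int_T f(\mathbf x_t)\,d\mu(t)$ exists in $M(A)$, we have $$\varphi\left(f\left(\int_T\mathbf x_t\,d\mu(t)\right)\right)\le\varphi\left(\int_T f(\mathbf x_t)\,d\mu(t)\right),\qquad\text{where } \int_T\mathbf x_t\,d\mu(t)=(y_1,\dots,y_n),$$ for every positive functional $\varphi$ on $A$ that contains $y_1,\dots,y_n$ in its centralizer. -/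

import Mathlib

open MeasureTheory Filter Topology
open scoped ComplexOrder MultiplierAlgebra

namespace JensenTrace

section JointFunctionalCalculus

variable {B : Type*} [CStarAlgebra B] {n : ℕ}

/-- The product of the spectra of the entries of an `n`-tuple. -/
def spectrumBox (x : Fin n → B) : Set (Fin n → ℝ) :=
  Set.univ.pi fun i => spectrum ℝ (x i)

/-- The `i`-th coordinate function on the product of the spectra, as a complex function. -/
def coordinate (x : Fin n → B) (i : Fin n) : C(spectrumBox x, ℂ) :=
  ⟨fun p => ((p.1 i : ℝ) : ℂ),
    Complex.continuous_ofReal.comp ((continuous_apply i).comp continuous_subtype_val)⟩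

/-- A real function that is continuous on the product of the spectra, as a complex continuous
function on that compact set. -/
def restrictToSpectrum (x : Fin n → B) (f : (Fin n → ℝ) → ℝ)
    (hf : ContinuousOn f (spectrumBox x)) : C(spectrumBox x, ℂ) :=
  ⟨fun p => ((f p.1 : ℝ) : ℂ),
    Complex.continuous_ofReal.comp (continuousOn_iff_continuous_domRestrict.mp hf)⟩

/-- A joint functional calculus of `x`: a unital `*`-homomorphism on the continuous functions on
the product of the spectra which sends the `i`-th coordinate function to `x i`. -/
def IsJointCalculus (x : Fin n → B) (Φ : C(spectrumBox x, ℂ) →⋆ₐ[ℂ] B) : Prop :=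
  ∀ i, Φ (coordinate x i) = x i

open Classical in
/-- `f(x) = f(x₁, …, xₙ)` for an abelian `n`-tuple `x` of self-adjoint elements of a unital
`C⋆`-algebra and a real function `f` that is continuous on the product of the spectra. (The value
is `0` if `x` has no joint functional calculus or `f` is not continuous there.) -/
noncomputable def jointCFC (f : (Fin n → ℝ) → ℝ) (x : Fin n → B) : B :=
  if h : (∃ Φ : C(spectrumBox x, ℂ) →⋆ₐ[ℂ] B, IsJointCalculus x Φ) ∧
      ContinuousOn f (spectrumBox x) then
    h.1.choose (restrictToSpectrum x f h.2)
  else 0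

theorem isCompact_spectrumBox (x : Fin n → B) : IsCompact (spectrumBox x) :=
  isCompact_univ_pi fun i => spectrum.isCompact (𝕜 := ℝ) (x i)

instance (x : Fin n → B) : CompactSpace (spectrumBox x) :=
  isCompact_iff_compactSpace.mp (isCompact_spectrumBox x)

/-- The joint functional calculus is unique. -/
theorem IsJointCalculus.unique {x : Fin n → B} {Φ Ψ : C(spectrumBox x, ℂ) →⋆ₐ[ℂ] B}
    (hΦ : IsJointCalculus x Φ) (hΨ : IsJointCalculus x Ψ) : Φ = Ψ := by
  have hsep : (StarAlgebra.adjoin ℂ (Set.range (coordinate x))).SeparatesPoints := by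
    intro p q hpq
    obtain ⟨i, hi⟩ : ∃ i, p.1 i ≠ q.1 i := by
      by_contra! h
      exact hpq (Subtype.ext (funext h))
    refine ⟨coordinate x i, ⟨coordinate x i,
      StarAlgebra.subset_adjoin ℂ _ (Set.mem_range_self i), rfl⟩, ?_⟩
    simpa [coordinate] using hi
  have htop := ContinuousMap.starSubalgebra_topologicalClosure_eq_top_of_separatesPoints _ hsep
  have hcΦ : Continuous Φ := NonUnitalStarAlgHom.instContinuousLinearMapClassComplex.map_continuous Φ
  have hcΨ : Continuous Ψ := NonUnitalStarAlgHom.instContinuousLinearMapClassComplex.map_continuous Ψ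
  have heq : StarAlgebra.adjoin ℂ (Set.range (coordinate x)) ≤ StarAlgHom.equalizer Φ Ψ := by
    rw [StarAlgebra.adjoin_le_iff]
    rintro _ ⟨i, rfl⟩
    exact (hΦ i).trans (hΨ i).symm
  ext g
  have hg : g ∈ (StarAlgebra.adjoin ℂ (Set.range (coordinate x))).topologicalClosure := by
    rw [htop]; trivial
  have hcl : IsClosed {g | Φ g = Ψ g} := isClosed_eq hcΦ hcΨ
  exact closure_minimal (fun g hg => heq hg) hcl hg

/-- The joint functional calculus exists for every abelian tuple of self-adjoint elements. -/
theorem exists_isJointCalculus {x : Fin n → B} (hsa : ∀ i, IsSelfAdjoint (x i))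
    (hcomm : ∀ i j, Commute (x i) (x j)) :
    ∃ Φ : C(spectrumBox x, ℂ) →⋆ₐ[ℂ] B, IsJointCalculus x Φ := by
  let S := StarAlgebra.adjoin ℂ (Set.range x)
  have h1 : ∀ a ∈ Set.range x, ∀ b ∈ Set.range x, a * b = b * a := by
    rintro _ ⟨i, rfl⟩ _ ⟨j, rfl⟩
    exact hcomm i j
  have h2 : ∀ a ∈ Set.range x, ∀ b ∈ Set.range x, a * star b = star b * a := by
    rintro _ ⟨i, rfl⟩ _ ⟨j, rfl⟩
    rw [(hsa j).star_eq]
    exact hcomm i j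
  have hS : IsMulCommutative S := StarAlgebra.isMulCommutative_adjoin ℂ h1 h2
  let C := S.topologicalClosure
  have hclosed : IsClosed (C : Set B) := S.isClosed_topologicalClosure
  let _ : CommRing C := S.commRingTopologicalClosure fun a b => hS.is_comm.comm a b
  let _ : CommCStarAlgebra C := { (inferInstance : CStarAlgebra C) with mul_comm := mul_comm }
  let xC : Fin n → C := fun i =>
    ⟨x i, S.le_topologicalClosure (StarAlgebra.subset_adjoin ℂ _ (Set.mem_range_self i))⟩
  have hre : ∀ (χ : WeakDual.characterSpace ℂ C) (i : Fin n), χ (xC i) = ((χ (xC i)).re : ℂ) ∧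
      (χ (xC i)).re ∈ spectrum ℝ (x i) := by
    intro χ i
    have hmem : χ (xC i) ∈ spectrum ℂ (x i) := by
      have h := AlgHom.apply_mem_spectrum χ (xC i)
      rwa [StarSubalgebra.spectrum_eq (hS := hclosed)] at h
    have heq : χ (xC i) = ((χ (xC i)).re : ℂ) := (hsa i).mem_spectrum_eq_re hmem
    refine ⟨heq, ?_⟩
    rw [heq] at hmem
    exact (spectrum.algebraMap_mem_iff ℂ).mp hmem
  let π : C(WeakDual.characterSpace ℂ C, spectrumBox x) :=
    ⟨fun χ => ⟨fun i => (χ (xC i)).re, fun i _ => (hre χ i).2⟩, by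
      refine Continuous.subtype_mk (continuous_pi fun i => Complex.continuous_re.comp ?_) _
      exact (WeakDual.gelfandTransform ℂ C (xC i)).continuous⟩
  refine ⟨(C.subtype.comp ((gelfandStarTransform C).symm : _ →⋆ₐ[ℂ] C)).comp
    (π.compStarAlgHom' ℂ ℂ), fun i => ?_⟩
  have h : π.compStarAlgHom' ℂ ℂ (coordinate x i) = gelfandStarTransform C (xC i) := by
    ext χ
    exact (hre χ i).1.symm
  change ((gelfandStarTransform C).symm (π.compStarAlgHom' ℂ ℂ (coordinate x i)) : B) = x i
  rw [h, StarAlgEquiv.symm_apply_apply]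

end JointFunctionalCalculus

section Multipliers

variable {A : Type*} [NonUnitalCStarAlgebra A] [PartialOrder A] [StarOrderedRing A]

/-- If all finite sums of a family of complex numbers are bounded by `M`, then all finite sums of the
absolute values are bounded by `4 * M`. -/
theorem sum_norm_le_of_sum_bounded {c : ℕ → ℂ} {M : ℝ}
    (h : ∀ F : Finset ℕ, ‖∑ k ∈ F, c k‖ ≤ M) (F : Finset ℕ) : ∑ k ∈ F, ‖c k‖ ≤ 4 * M := by
  have key : ∀ u : ℕ → ℝ, (∀ F : Finset ℕ, |∑ k ∈ F, u k| ≤ M) → ∑ k ∈ F, |u k| ≤ 2 * M := by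
    intro u hu
    rw [← Finset.sum_filter_add_sum_filter_not F (fun k => 0 ≤ u k)]
    have h1 : ∑ k ∈ F with 0 ≤ u k, |u k| = ∑ k ∈ F with 0 ≤ u k, u k :=
      Finset.sum_congr rfl fun k hk => abs_of_nonneg (Finset.mem_filter.mp hk).2
    have h2 : ∑ k ∈ F with ¬ 0 ≤ u k, |u k| = -∑ k ∈ F with ¬ 0 ≤ u k, u k := by
      rw [← Finset.sum_neg_distrib]
      exact Finset.sum_congr rfl fun k hk =>
        abs_of_neg (not_le.mp (Finset.mem_filter.mp hk).2)
    rw [h1, h2]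
    have h3 := (abs_le.mp (hu {k ∈ F | 0 ≤ u k})).2
    have h4 := (abs_le.mp (hu {k ∈ F | ¬ 0 ≤ u k})).1
    linarith
  have hre := key (fun k => (c k).re) fun F => by
    rw [← Complex.re_sum]
    exact (Complex.abs_re_le_norm _).trans (h F)
  have him := key (fun k => (c k).im) fun F => by
    rw [← Complex.im_sum]
    exact (Complex.abs_im_le_norm _).trans (h F)
  calc ∑ k ∈ F, ‖c k‖ ≤ ∑ k ∈ F, (|(c k).re| + |(c k).im|) :=
        Finset.sum_le_sum fun k _ => Complex.norm_le_abs_re_add_abs_im _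
    _ ≤ 4 * M := by rw [Finset.sum_add_distrib]; linarith

/-- A bounded functional converges along the canonical approximate unit. -/
theorem exists_tendsto_approximateUnit (ψ : A →L[ℂ] ℂ) :
    ∃ c, Tendsto ψ (CStarAlgebra.approximateUnit A) (𝓝 c) := by
  suffices hC : Cauchy (map ψ (CStarAlgebra.approximateUnit A)) from
    CompleteSpace.complete hC
  by_contra hnot
  have hbasis := CStarAlgebra.hasBasis_approximateUnit A
  obtain ⟨ε, hε, hstep⟩ : ∃ ε > 0, ∀ e : A, 0 ≤ e → ‖e‖ < 1 →
      ∃ e', e ≤ e' ∧ ‖e'‖ ≤ 1 ∧ ε ≤ ‖ψ e' - ψ e‖ := by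
    by_contra! hcon
    refine hnot (Metric.cauchy_iff.mpr ⟨inferInstance, fun δ hδ => ?_⟩)
    obtain ⟨e, he0, he1, he⟩ := hcon (δ / 2) (by positivity)
    refine ⟨ψ '' ({x | e ≤ x} ∩ Metric.closedBall 0 1),
      image_mem_map (hbasis.mem_of_mem ⟨he0, he1⟩), ?_⟩
    rintro _ ⟨p, ⟨hp, hp1⟩, rfl⟩ _ ⟨q, ⟨hq, hq1⟩, rfl⟩
    have h1 := he p hp (mem_closedBall_zero_iff.mp hp1)
    have h2 := he q hq (mem_closedBall_zero_iff.mp hq1)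
    rw [← dist_eq_norm] at h1 h2
    have := dist_triangle_right (ψ p) (ψ q) (ψ e)
    linarith
  have hstep' : ∀ e : {e : A // 0 ≤ e ∧ ‖e‖ < 1}, ∃ e' : {e : A // 0 ≤ e ∧ ‖e‖ < 1},
      (e : A) ≤ e' ∧ ε / 2 ≤ ‖ψ ((e' : A) - e)‖ := by
    rintro ⟨e, he0, he1⟩
    obtain ⟨e', hle, hn, hd⟩ := hstep e he0 he1
    have hsub : e + (2⁻¹ : ℝ) • (e' - e) = (2⁻¹ : ℝ) • e + (2⁻¹ : ℝ) • e' := by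
      rw [smul_sub]
      nth_rewrite 1 [show e = (2⁻¹ : ℝ) • e + (2⁻¹ : ℝ) • e by rw [← add_smul]; norm_num]
      abel
    have hle' : e ≤ e + (2⁻¹ : ℝ) • (e' - e) :=
      le_add_of_nonneg_right (smul_nonneg (by norm_num) (sub_nonneg.mpr hle))
    refine ⟨⟨e + (2⁻¹ : ℝ) • (e' - e), he0.trans hle', ?_⟩, hle', ?_⟩
    · rw [hsub]
      refine (norm_add_le _ _).trans_lt ?_
      rw [norm_smul, norm_smul]
      norm_num
      linarith
    · have hr : (2⁻¹ : ℝ) • (e' - e) = (2⁻¹ : ℂ) • (e' - e) := by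
        rw [← Complex.coe_smul]; norm_num
      simp only [add_sub_cancel_left]
      rw [hr, map_smul, norm_smul, map_sub]
      norm_num
      linarith
  choose next hnext using hstep'
  let E : ℕ → {e : A // 0 ≤ e ∧ ‖e‖ < 1} := fun k => next^[k] ⟨0, le_rfl, by simp⟩
  have hE : ∀ k, E (k + 1) = next (E k) := fun k => Function.iterate_succ_apply' _ _ _
  have hd : ∀ k, 0 ≤ (E (k + 1) : A) - E k := fun k => by
    rw [hE, sub_nonneg]; exact (hnext (E k)).1
  have hbound : ∀ F : Finset ℕ, ‖∑ k ∈ F, ψ ((E (k + 1) : A) - E k)‖ ≤ ‖ψ‖ := by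
    intro F
    obtain ⟨N, hN⟩ := F.exists_nat_subset_range
    rw [← map_sum]
    have h0 : 0 ≤ ∑ k ∈ F, ((E (k + 1) : A) - E k) := Finset.sum_nonneg fun k _ => hd k
    have h1 : ∑ k ∈ F, ((E (k + 1) : A) - E k) ≤ E N := by
      refine (Finset.sum_le_sum_of_subset_of_nonneg hN fun k _ _ => hd k).trans ?_
      rw [Finset.sum_range_sub (fun k => (E k : A))]
      simp [E]
    have h2 := CStarAlgebra.norm_le_norm_of_nonneg_of_le h0 h1
    have h3 : ‖∑ k ∈ F, ((E (k + 1) : A) - E k)‖ ≤ 1 := h2.trans (E N).2.2.le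
    calc _ ≤ ‖ψ‖ * ‖∑ k ∈ F, ((E (k + 1) : A) - E k)‖ := ψ.le_opNorm _
      _ ≤ ‖ψ‖ * 1 := by gcongr
      _ = ‖ψ‖ := mul_one _
  obtain ⟨N, hN⟩ := exists_nat_gt (4 * ‖ψ‖ / (ε / 2))
  have h1 := sum_norm_le_of_sum_bounded hbound (Finset.range N)
  have h2 : N * (ε / 2) ≤ ∑ k ∈ Finset.range N, ‖ψ ((E (k + 1) : A) - E k)‖ := by
    have := Finset.card_nsmul_le_sum (Finset.range N)
      (fun k => ‖ψ ((E (k + 1) : A) - E k)‖) (ε / 2) fun k _ => by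
        rw [hE]; exact (hnext (E k)).2
    simpa using this
  rw [div_lt_iff₀ (by positivity)] at hN
  linarith

/-- The canonical extension to the multiplier algebra `M(A)` of a functional `ψ` on `A`:
`ψ(m) = lim ψ(m e)`, where `e` runs through the canonical approximate unit of `A`. -/
noncomputable def extend (ψ : A →ₗ[ℂ] ℂ) (m : 𝓜(ℂ, A)) : ℂ :=
  limUnder (CStarAlgebra.approximateUnit A) fun e => ψ (m.fst e)

/-- The limit that defines the canonical extension of a bounded functional exists. -/
theorem tendsto_extend (ψ : A →L[ℂ] ℂ) (m : 𝓜(ℂ, A)) :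
    Tendsto (fun e => ψ (m.fst e)) (CStarAlgebra.approximateUnit A)
      (𝓝 (extend (ψ : A →ₗ[ℂ] ℂ) m)) :=
  tendsto_nhds_limUnder (exists_tendsto_approximateUnit (ψ.comp m.fst))

/-- The canonical extension agrees with the functional on `A`. -/
theorem extend_coe (ψ : A →L[ℂ] ℂ) (a : A) : extend (ψ : A →ₗ[ℂ] ℂ) (a : 𝓜(ℂ, A)) = ψ a := by
  refine Tendsto.limUnder_eq ?_
  have h := (CStarAlgebra.increasingApproximateUnit A).tendsto_mul_left a
  exact (ψ.continuous.tendsto a).comp h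

/-- A field `(m_t)` in `M(A)` is weak* measurable if `t ↦ ψ(m_t)` is `μ`-measurable for every
`ψ ∈ A*`. -/
def WeakStarMeasurable {T : Type*} [MeasurableSpace T] (m : T → 𝓜(ℂ, A)) (μ : Measure T) : Prop :=
  ∀ ψ : A →L[ℂ] ℂ, AEStronglyMeasurable (fun t => extend (ψ : A →ₗ[ℂ] ℂ) (m t)) μ

/-- `z` is the integral `∫ m_t dμ(t)` of the field `(m_t)` in `M(A)`: for every `ψ ∈ A*` the
function `t ↦ ψ(m_t)` is integrable, with integral `ψ(z)`. -/
def HasWeakIntegral {T : Type*} [MeasurableSpace T] (m : T → 𝓜(ℂ, A)) (μ : Measure T)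
    (z : 𝓜(ℂ, A)) : Prop :=
  ∀ ψ : A →L[ℂ] ℂ, Integrable (fun t => extend (ψ : A →ₗ[ℂ] ℂ) (m t)) μ ∧
    ∫ t, extend (ψ : A →ₗ[ℂ] ℂ) (m t) ∂μ = extend (ψ : A →ₗ[ℂ] ℂ) z

/-- The centralizer of a positive functional `φ` on `A`. -/
def centralizer (φ : A →ₚ[ℂ] ℂ) : Set A :=
  {y | ∀ x, φ (x * y) = φ (y * x)}

end Multipliers

end JensenTrace

/-!
Since `A` is separable, Pettis' theorem makes the bounded weak* measurable fields `x i` strongly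
measurable, so their integrals `y i` exist as Bochner integrals in `A` and can be handled in norm.
Averaging the relation `[x i t, x j s] = [x j t, x i s]` over `s` and `t` gives
`[y i, y j] = -[y i, y j]`, so the `y i` commute. A point `p` outside an interval `I i` has the whole
interval on one side, and for large `r` "spectrum to the right of `p`" means `‖r - b‖ < r - p`; this
strict inequality survives averaging, whence the spectrum of `y i` lies in `I i`.

The field `f(x t)` is strongly measurable too: on a compact box this follows from Stone–Weierstrass,
and in general `f` is approximated by its compositions with retractions of the intervals onto compact
subintervals. So `f(x t)` has a Bochner integral in `M(A)` as soon as it is bounded or its norm is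
integrable.

For the inequality, let `ω` be the canonical extension of `φ` to `M(A)`. It is bounded, positive
(by Cauchy–Schwarz, `ω(m) = lim φ(e m e)`), and satisfies `ω(y i * m) = ω(m * y i)`. On the compact
product `K` of the spectra of the `y i` there are affine minorants `l j ≤ f` and a continuous
partition of unity `g j` with `f - 2ε ≤ ∑ g j * l j`. As `ω` is tracial against the functions of `y`,
each `ω(g j(y) · ) = ω(√(g j)(y) · √(g j)(y))` is positive, and so
`ω(f(y)) - 2ε ω(1) ≤ ∑ ω(g j(y) l j(y)) = ∫ ∑ ω(g j(y) l j(x t)) dμ(t) ≤ ∫ ω(f(x t)) dμ(t)`.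
The equality holds because `l j` is affine, and the last step because `l j(x t) ≤ f(x t)` and
`∑ g j(y) = 1`. No disintegration of `φ` over `K` is needed.
-/

namespace JensenTrace

/-! ### Affine minorants of convex functions -/

/-- A continuous convex function on an arbitrary convex set has affine minorants that come
arbitrarily close to it at any prescribed point. The set need not be closed: continuity at the
point already separates it from the closure of the epigraph. -/
theorem exists_affine_le_of_lt {E : Type*} [NormedAddCommGroup E] [NormedSpace ℝ E]
    {s : Set E} {f : E → ℝ} (hf : ConvexOn ℝ s f) (hc : ContinuousOn f s) {x : E} (hx : x ∈ s)
    {a : ℝ} (ha : a < f x) :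
    ∃ (l : E →L[ℝ] ℝ) (c : ℝ), (∀ y ∈ s, l y + c ≤ f y) ∧ l x + c = a := by
  let S : Set (E × ℝ) := {p | p.1 ∈ s ∧ f p.1 ≤ p.2}
  have hnot : (x, a) ∉ closure S := by
    obtain ⟨b, hab, hb⟩ := exists_between ha
    have h1 : ∀ᶠ y in 𝓝 x, y ∈ s → b < f y :=
      eventually_nhdsWithin_iff.mp ((hc x hx).eventually (lt_mem_nhds hb))
    have h2 : ∀ᶠ p : E × ℝ in 𝓝 (x, a), p ∉ S := by
      rw [nhds_prod_eq]
      filter_upwards [h1.prod_mk (gt_mem_nhds hab)] with p hp hS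
      linarith [hp.1 hS.1, hp.2, hS.2]
    rw [mem_closure_iff_frequently]
    exact fun h => h h2
  obtain ⟨L, β, hL, hβ⟩ := geometric_hahn_banach_point_closed
    (hf.convex_epigraph.closure) isClosed_closure hnot
  have hdec : ∀ y r, L (y, r) = L (y, 0) + r * L (0, 1) := by
    intro y r
    have h : (y, r) = (y, (0 : ℝ)) + r • ((0 : E), (1 : ℝ)) := by simp
    rw [h, map_add, map_smul, smul_eq_mul]
  have hlt : ∀ y ∈ s, L (x, 0) + a * L (0, 1) < L (y, 0) + f y * L (0, 1) := by
    intro y hy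
    rw [← hdec, ← hdec]
    exact hL.trans (hβ _ (subset_closure ⟨hy, le_rfl⟩))
  have hγ : 0 < L (0, 1) := by
    have := hlt x hx
    nlinarith
  refine ⟨-(L (0, 1))⁻¹ • L.comp (ContinuousLinearMap.inl ℝ E ℝ),
    (L (0, 1))⁻¹ * L (x, 0) + a, fun y hy => ?_, ?_⟩
  · have h := mul_le_mul_of_nonneg_left (hlt y hy).le (inv_pos.mpr hγ).le
    have h1 : (L (0, 1))⁻¹ * (L (x, 0) + a * L (0, 1)) = (L (0, 1))⁻¹ * L (x, 0) + a := by
      field_simp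
    have h2 : (L (0, 1))⁻¹ * (L (y, 0) + f y * L (0, 1)) = (L (0, 1))⁻¹ * L (y, 0) + f y := by
      field_simp
    rw [h1, h2] at h
    simp only [_root_.smul_apply, ContinuousLinearMap.comp_apply,
      ContinuousLinearMap.inl_apply, smul_eq_mul]
    linarith
  · simp only [_root_.smul_apply, ContinuousLinearMap.comp_apply,
      ContinuousLinearMap.inl_apply, smul_eq_mul]
    ring

/-- On a compact set, a continuous convex function is up to `2 * ε` a combination of affine
minorants of the function, with a continuous partition of unity as coefficients. -/
theorem exists_partition_affine_le {E : Type*} [NormedAddCommGroup E] [NormedSpace ℝ E]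
    {s : Set E} {f : E → ℝ} (hf : ConvexOn ℝ s f) (hc : ContinuousOn f s) {K : Set E}
    (hK : IsCompact K) (hKs : K ⊆ s) {ε : ℝ} (hε : 0 < ε) :
    ∃ (J : Finset E) (l : E → E →L[ℝ] ℝ) (c : E → ℝ) (g : E → C(K, ℝ)),
      (∀ j ∈ J, ∀ y ∈ s, l j y + c j ≤ f y) ∧ (∀ j p, 0 ≤ g j p) ∧
      (∀ p : K, ∑ j ∈ J, g j p = 1) ∧
      ∀ p : K, f p - 2 * ε ≤ ∑ j ∈ J, g j p * (l j p + c j) := by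
  have hex : ∀ x : E, ∃ (l : E →L[ℝ] ℝ) (c : ℝ),
      x ∈ s → (∀ y ∈ s, l y + c ≤ f y) ∧ l x + c = f x - ε := by
    intro x
    by_cases hx : x ∈ s
    · obtain ⟨l, c, h⟩ := exists_affine_le_of_lt hf hc hx (sub_lt_self (f x) hε)
      exact ⟨l, c, fun _ => h⟩
    · exact ⟨0, 0, fun h => absurd h hx⟩
  choose l c hlc using hex
  have hfK : Continuous fun p : K => f p := continuousOn_iff_continuous_domRestrict.mp (hc.mono hKs)
  -- `u j` is positive exactly where the `j`-th affine function is within `2 * ε` of `f`.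
  let u : E → C(K, ℝ) := fun j => ⟨fun p => max (l j p + c j - f p + 2 * ε) 0, by
    have hlK : Continuous fun p : K => l j p := (l j).continuous.comp continuous_subtype_val
    exact (((hlK.add continuous_const).sub hfK).add continuous_const).max continuous_const⟩
  have hu0 : ∀ j p, 0 ≤ u j p := fun j p => le_max_right _ _
  have hcompact : CompactSpace K := isCompact_iff_compactSpace.mp hK
  obtain ⟨J', hJ'⟩ := isCompact_univ.elim_finite_subcover (fun j : K => {p | 0 < u j p})
    (fun j => isOpen_lt continuous_const (u j).continuous) (fun p _ => by
      refine Set.mem_iUnion.mpr ⟨p, ?_⟩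
      have h := (hlc p (hKs p.2)).2
      change 0 < max (l p p + c p - f p + 2 * ε) 0
      rw [h]
      exact lt_max_of_lt_left (by linarith))
  classical
  let J : Finset E := J'.image Subtype.val
  have hpos : ∀ p, 0 < ∑ j ∈ J, u j p := by
    intro p
    obtain ⟨j, hj, hp⟩ := Set.mem_iUnion₂.mp (hJ' (Set.mem_univ p))
    exact Finset.sum_pos' (fun i _ => hu0 i p) ⟨j, Finset.mem_image_of_mem _ hj, hp⟩
  refine ⟨J, l, c, fun j => ⟨fun p => u j p / ∑ i ∈ J, u i p, ?_⟩, ?_, ?_, ?_, ?_⟩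
  · exact (u j).continuous.div (continuous_finsetSum _ fun i _ => (u i).continuous)
      fun p => (hpos p).ne'
  · intro j hj
    obtain ⟨j, -, rfl⟩ := Finset.mem_image.mp hj
    exact (hlc j (hKs j.2)).1
  · exact fun j p => div_nonneg (hu0 j p) (hpos p).le
  · intro p
    change ∑ j ∈ J, u j p / ∑ i ∈ J, u i p = 1
    rw [← Finset.sum_div, div_self (hpos p).ne']
  · intro p
    change _ ≤ ∑ j ∈ J, u j p / (∑ i ∈ J, u i p) * (l j p + c j)
    have h1 : f p - 2 * ε = ∑ j ∈ J, u j p / (∑ i ∈ J, u i p) * (f p - 2 * ε) := by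
      rw [← Finset.sum_mul, ← Finset.sum_div, div_self (hpos p).ne', one_mul]
    rw [h1]
    refine Finset.sum_le_sum fun j _ => ?_
    rcases (hu0 j p).eq_or_lt with h0 | h0
    · rw [← h0]; simp
    · refine mul_le_mul_of_nonneg_left ?_ (div_nonneg h0.le (hpos p).le)
      have : 0 < l j p + c j - f p + 2 * ε := (lt_max_iff.mp h0).resolve_right (lt_irrefl _)
      linarith

/-! ### Retractions onto compact subintervals -/

/-- Continuous retractions of the line onto compact subintervals which exhaust an interval. -/
theorem exists_retraction_seq {I : Set ℝ} (hI : I.OrdConnected) (hne : I.Nonempty) :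
    ∃ r : ℕ → ℝ → ℝ, (∀ k, Continuous (r k)) ∧ (∀ k p, r k p ∈ I) ∧
      ∀ S ⊆ I, IsCompact S → ∀ᶠ k in atTop, ∀ p ∈ S, r k p = p := by
  have : Nonempty I := hne.to_subtype
  obtain ⟨a, ha⟩ := exists_seq_tendsto (atBot : Filter I)
  obtain ⟨b, hb⟩ := exists_seq_tendsto (atTop : Filter I)
  refine ⟨fun k p => max (a k) (min (b k) p), fun k => by fun_prop, fun k p => ?_,
    fun S hS hSc => ?_⟩
  · change max (a k : ℝ) (min (b k) p) ∈ I
    rcases le_total (a k : ℝ) (min (b k) p) with h | h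
    · rw [max_eq_right h]
      exact hI.out (a k).2 (b k).2 ⟨h, min_le_left _ _⟩
    · rw [max_eq_left h]
      exact (a k).2
  · rcases S.eq_empty_or_nonempty with rfl | hSne
    · simp
    obtain ⟨u, hu⟩ := hSc.exists_isLeast hSne
    obtain ⟨v, hv⟩ := hSc.exists_isGreatest hSne
    filter_upwards [ha.eventually (eventually_le_atBot ⟨u, hS hu.1⟩),
      hb.eventually (eventually_ge_atTop ⟨v, hS hv.1⟩)] with k hak hbk p hp
    have h1 : (a k : ℝ) ≤ p := le_trans hak (hu.2 hp)
    have h2 : p ≤ (b k : ℝ) := le_trans (hv.2 hp) hbk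
    rw [min_eq_right h2, max_eq_right h1]

/-! ### Weak measurability in separable spaces -/

/-- Pettis' theorem in a separable Banach space: a weakly measurable map is strongly measurable. -/
theorem aestronglyMeasurable_of_forall_dual {𝕜 E : Type*} [RCLike 𝕜] [NormedAddCommGroup E]
    [NormedSpace 𝕜 E] [CompleteSpace E] [TopologicalSpace.SeparableSpace E]
    {T : Type*} [MeasurableSpace T] {μ : Measure T} {g : T → E}
    (h : ∀ ψ : E →L[𝕜] 𝕜, AEStronglyMeasurable (fun t => ψ (g t)) μ) :
    AEStronglyMeasurable g μ := by
  have hψ : ∀ d : E, ∃ ψ : E →L[𝕜] 𝕜, ‖ψ‖ ≤ 1 ∧ ψ d = ‖d‖ := fun d =>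
    exists_dual_vector'' 𝕜 d
  choose ψ hψ1 hψd using hψ
  let d := TopologicalSpace.denseSeq E
  let F : E → ℕ → 𝕜 := fun a k => ψ (d k) a
  have hF : Continuous F := continuous_pi fun k => (ψ (d k)).continuous
  have hinj : Function.Injective F := by
    intro a b hab
    by_contra hne
    have hpos : 0 < ‖a - b‖ / 2 := half_pos (norm_pos_iff.mpr (sub_ne_zero.mpr hne))
    obtain ⟨k, hk⟩ := (TopologicalSpace.denseRange_denseSeq E).exists_dist_lt (a - b) hpos
    change dist (a - b) (d k) < _ at hk
    rw [dist_eq_norm] at hk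
    have h0 : ψ (d k) (a - b) = 0 := by
      rw [map_sub, sub_eq_zero]; exact congrFun hab k
    have h1 : ‖d k‖ ≤ ‖a - b - d k‖ := by
      have h2 := (ψ (d k)).le_of_opNorm_le (hψ1 _) (a - b - d k)
      rwa [map_sub, h0, hψd, zero_sub, norm_neg, RCLike.norm_ofReal, abs_norm, one_mul] at h2
    have h3 := norm_add_le (a - b - d k) (d k)
    rw [sub_add_cancel] at h3
    linarith
  let _ : MeasurableSpace E := borel E
  have : BorelSpace E := ⟨rfl⟩
  have : SecondCountableTopology E := UniformSpace.secondCountable_of_separable E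
  have hmeas : AEMeasurable (fun t => F (g t)) μ :=
    aemeasurable_pi_lambda _ fun k => (h (ψ (d k))).aemeasurable
  exact ((hF.measurableEmbedding hinj).aemeasurable_comp_iff.mp hmeas).aestronglyMeasurable

/-! ### Joint functional calculus with real functions on a compact set -/

section RealCalculus

variable {n : ℕ}

/-- The `i`-th coordinate function on a subset of `ℝⁿ`. -/
def realCoordinate (K : Set (Fin n → ℝ)) (i : Fin n) : C(K, ℝ) :=
  ⟨fun p => p.1 i, (continuous_apply i).comp continuous_subtype_val⟩

/-- Stone–Weierstrass induction: a closed property of continuous real functions on a compact subset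
of `ℝⁿ` which is stable under sums and products holds for all of them if it holds for constants and
coordinate functions. -/
theorem induction_on_realCoordinate {K : Set (Fin n → ℝ)} [CompactSpace K] {P : C(K, ℝ) → Prop}
    (const : ∀ r : ℝ, P (algebraMap ℝ C(K, ℝ) r)) (coord : ∀ i, P (realCoordinate K i))
    (add : ∀ g h, P g → P h → P (g + h)) (mul : ∀ g h, P g → P h → P (g * h))
    (closed : IsClosed {g | P g}) (g : C(K, ℝ)) : P g := by
  let S : Subalgebra ℝ C(K, ℝ) :=
    { carrier := {g | P g}
      mul_mem' := fun {a b} ha hb => mul a b ha hb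
      add_mem' := fun {a b} ha hb => add a b ha hb
      algebraMap_mem' := const }
  have htop := ContinuousMap.subalgebra_topologicalClosure_eq_top_of_separatesPoints S (by
    intro p q hpq
    obtain ⟨i, hi⟩ : ∃ i, p.1 i ≠ q.1 i := by
      by_contra! h
      exact hpq (Subtype.ext (funext h))
    exact ⟨_, ⟨realCoordinate K i, coord i, rfl⟩, hi⟩)
  have hg : g ∈ S.topologicalClosure := by rw [htop]; trivial
  exact closure_minimal (fun _ h => h) closed hg

variable {B : Type*} [CStarAlgebra B]

/-- `Ψ` is the joint functional calculus of the tuple `x` for real functions on a compact set `K`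
that contains the product of the spectra. Working with a common `K` makes the calculi of different
tuples comparable. -/
structure IsRealCalculus (x : Fin n → B) (K : Set (Fin n → ℝ)) [CompactSpace K]
    (Ψ : C(K, ℝ) →ₐ[ℝ] B) : Prop where
  apply_coordinate : ∀ i, Ψ (realCoordinate K i) = x i
  isSelfAdjoint : ∀ g, IsSelfAdjoint (Ψ g)
  norm_le : ∀ g, ‖Ψ g‖ ≤ ‖g‖
  jointCFC_eq : ∀ (f : (Fin n → ℝ) → ℝ) (g : C(K, ℝ)), (∀ p : K, g p = f p) → jointCFC f x = Ψ g

theorem IsRealCalculus.continuous {x : Fin n → B} {K : Set (Fin n → ℝ)} [CompactSpace K]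
    {Ψ : C(K, ℝ) →ₐ[ℝ] B} (hΨ : IsRealCalculus x K Ψ) : Continuous Ψ :=
  AddMonoidHomClass.continuous_of_bound Ψ 1 fun g => by simpa using hΨ.norm_le g

theorem exists_isRealCalculus {x : Fin n → B} (hsa : ∀ i, IsSelfAdjoint (x i))
    (hcomm : ∀ i j, Commute (x i) (x j)) {K : Set (Fin n → ℝ)} [CompactSpace K]
    (hK : spectrumBox x ⊆ K) : ∃ Ψ : C(K, ℝ) →ₐ[ℝ] B, IsRealCalculus x K Ψ := by
  obtain ⟨Φ, hΦ⟩ := exists_isJointCalculus hsa hcomm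
  let ι : C(K, ℝ) → C(spectrumBox x, ℂ) := fun g =>
    ⟨fun p => ((g ⟨p.1, hK p.2⟩ : ℝ) : ℂ), Complex.continuous_ofReal.comp
      (g.continuous.comp (continuous_subtype_val.subtype_mk _))⟩
  let Ψ : C(K, ℝ) →ₐ[ℝ] B :=
    { toFun := fun g => Φ (ι g)
      map_one' := by
        rw [← map_one Φ]; congr 1
      map_mul' := fun g h => by
        rw [← map_mul]; congr 1; ext p; simp [ι]
      map_zero' := by
        rw [← map_zero Φ]; congr 1
      map_add' := fun g h => by
        rw [← map_add]; congr 1; ext p; simp [ι]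
      commutes' := fun r => by
        have h : ι (algebraMap ℝ C(K, ℝ) r) = algebraMap ℂ C(spectrumBox x, ℂ) (r : ℂ) := by
          ext p; simp [ι]
        rw [h, AlgHomClass.commutes]
        exact (IsScalarTower.algebraMap_apply ℝ ℂ B r).symm }
  refine ⟨Ψ, fun i => hΦ i, fun g => ?_, fun g => ?_, fun f g hfg => ?_⟩
  · change star (Φ (ι g)) = Φ (ι g)
    rw [← map_star]; congr 1; ext p; simp [ι]
  · refine (NonUnitalStarAlgHom.norm_apply_le Φ (ι g)).trans ?_
    rw [ContinuousMap.norm_le _ (norm_nonneg g)]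
    intro p
    change ‖((g ⟨p.1, hK p.2⟩ : ℝ) : ℂ)‖ ≤ _
    rw [Complex.norm_real]
    exact g.norm_coe_le_norm _
  · have hfc : ContinuousOn f (spectrumBox x) := by
      refine ContinuousOn.mono ?_ hK
      rw [continuousOn_iff_continuous_domRestrict]
      exact g.continuous.congr hfg
    have h : (∃ Φ : C(spectrumBox x, ℂ) →⋆ₐ[ℂ] B, IsJointCalculus x Φ) ∧
        ContinuousOn f (spectrumBox x) := ⟨⟨Φ, hΦ⟩, hfc⟩
    rw [jointCFC, dif_pos h, h.1.choose_spec.unique hΦ]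
    change Φ _ = Φ (ι g)
    congr 1
    ext p
    exact congrArg Complex.ofReal (hfg ⟨p.1, hK p.2⟩).symm

/-- Only the values of the function on the product of the spectra matter. -/
theorem jointCFC_congr {x : Fin n → B} (hsa : ∀ i, IsSelfAdjoint (x i))
    (hcomm : ∀ i j, Commute (x i) (x j)) {f g : (Fin n → ℝ) → ℝ}
    (hf : ContinuousOn f (spectrumBox x)) (hfg : Set.EqOn f g (spectrumBox x)) :
    jointCFC f x = jointCFC g x := by
  obtain ⟨Ψ, hΨ⟩ := exists_isRealCalculus hsa hcomm subset_rfl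
  let F : C(spectrumBox x, ℝ) := ⟨fun p => f p, continuousOn_iff_continuous_domRestrict.mp hf⟩
  rw [hΨ.jointCFC_eq f F fun _ => rfl, hΨ.jointCFC_eq g F fun p => hfg p.2]

theorem norm_jointCFC_le {x : Fin n → B} (hsa : ∀ i, IsSelfAdjoint (x i))
    (hcomm : ∀ i j, Commute (x i) (x j)) {f : (Fin n → ℝ) → ℝ}
    (hf : ContinuousOn f (spectrumBox x)) {C : ℝ} (hC : 0 ≤ C)
    (hfC : ∀ p ∈ spectrumBox x, |f p| ≤ C) : ‖jointCFC f x‖ ≤ C := by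
  obtain ⟨Ψ, hΨ⟩ := exists_isRealCalculus hsa hcomm subset_rfl
  let F : C(spectrumBox x, ℝ) := ⟨fun p => f p, continuousOn_iff_continuous_domRestrict.mp hf⟩
  rw [hΨ.jointCFC_eq f F fun _ => rfl]
  exact (hΨ.norm_le F).trans ((ContinuousMap.norm_le _ hC).mpr fun p => hfC p p.2)

/-! ### Spectra -/

theorem abs_le_norm_of_mem_spectrum {b : B} {p : ℝ} (hp : p ∈ spectrum ℝ b) : |p| ≤ ‖b‖ := by
  have h := spectrum.norm_le_norm_mul_of_mem hp
  have h1 : ‖(1 : B)‖ ≤ 1 := by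
    rcases subsingleton_or_nontrivial B with _ | _
    · rw [Subsingleton.elim (1 : B) 0, norm_zero]; exact zero_le_one
    · exact CStarRing.norm_one.le
  exact h.trans (mul_le_of_le_one_right (norm_nonneg b) h1)

theorem norm_algebraMap_sub_lt {b : B} (hb : IsSelfAdjoint b) {l r : ℝ} (hlr : l < r)
    (hbr : ‖b‖ ≤ r) (hl : ∀ p ∈ spectrum ℝ b, l < p) : ‖algebraMap ℝ B r - b‖ < r - l := by
  have h : algebraMap ℝ B r - b = cfc (fun p : ℝ => r - p) b := by
    rw [cfc_sub .., cfc_const r b, cfc_id' ℝ b]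
  rw [h]
  refine norm_cfc_lt (sub_pos.mpr hlr) fun p hp => ?_
  have h1 := (le_abs_self p).trans ((abs_le_norm_of_mem_spectrum hp).trans hbr)
  rw [Real.norm_of_nonneg (sub_nonneg.mpr h1)]
  linarith [hl p hp]

variable {T : Type*} [MeasurableSpace T] {μ : Measure T}

/-- The average of a bounded field of self-adjoint elements with spectra to the right of `l` has its
spectrum to the right of `l`: for large `r`, the spectrum of `b` lies to the right of `l` if and
only if `‖r - b‖ < r - l`, and this norm condition survives averaging. -/
theorem lt_of_mem_spectrum_integral [IsProbabilityMeasure μ] {m : T → B} (hm : Integrable m μ)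
    {C : ℝ} (hC : ∀ t, ‖m t‖ ≤ C) (hsa : ∀ t, IsSelfAdjoint (m t)) {l : ℝ}
    (hl : ∀ t, ∀ p ∈ spectrum ℝ (m t), l < p) {p : ℝ} (hp : p ∈ spectrum ℝ (∫ t, m t ∂μ)) :
    l < p := by
  let r := max C (l + 1)
  have hlr : l < r := (lt_add_one l).trans_le (le_max_right _ _)
  have hlt : ∀ t, ‖algebraMap ℝ B r - m t‖ < r - l := fun t =>
    norm_algebraMap_sub_lt (hsa t) hlr ((hC t).trans (le_max_left _ _)) (hl t)
  have hint : Integrable (fun t => algebraMap ℝ B r - m t) μ := (integrable_const _).sub hm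
  have h1 : ∫ t, (algebraMap ℝ B r - m t) ∂μ = algebraMap ℝ B r - ∫ t, m t ∂μ := by
    rw [integral_sub (integrable_const _) hm]; simp
  have h2 : ∫ t, ‖algebraMap ℝ B r - m t‖ ∂μ < r - l := by
    have hint' : Integrable (fun t => (r - l) - ‖algebraMap ℝ B r - m t‖) μ :=
      (integrable_const _).sub hint.norm
    have hpos : 0 < ∫ t, ((r - l) - ‖algebraMap ℝ B r - m t‖) ∂μ := by
      rw [integral_pos_iff_support_of_nonneg (fun t => (sub_pos.mpr (hlt t)).le) hint']
      have hsupp : Function.support (fun t => (r - l) - ‖algebraMap ℝ B r - m t‖) = Set.univ :=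
        Set.eq_univ_of_forall fun t => (sub_pos.mpr (hlt t)).ne'
      rw [hsupp, measure_univ]
      exact one_pos
    rw [integral_sub (integrable_const _) hint.norm] at hpos
    simpa using hpos
  have h3 : r - p ∈ spectrum ℝ (algebraMap ℝ B r - ∫ t, m t ∂μ) := by
    rw [← spectrum.singleton_sub_eq]
    exact Set.sub_mem_sub rfl hp
  have h4 := abs_le_norm_of_mem_spectrum h3
  rw [← h1] at h4
  have h5 := norm_integral_le_integral_norm (μ := μ) fun t => algebraMap ℝ B r - m t
  linarith [le_abs_self (r - p)]

/-- The average of a bounded field of self-adjoint elements with spectra in an interval, of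
whatever kind, has its spectrum in that interval. -/
theorem spectrum_integral_subset [IsProbabilityMeasure μ] {m : T → B} (hm : Integrable m μ)
    {C : ℝ} (hC : ∀ t, ‖m t‖ ≤ C) (hsa : ∀ t, IsSelfAdjoint (m t)) {I : Set ℝ}
    (hI : I.OrdConnected) (hmI : ∀ t, spectrum ℝ (m t) ⊆ I) :
    spectrum ℝ (∫ t, m t ∂μ) ⊆ I := by
  intro p hp
  by_contra hpI
  have hside : (∀ q ∈ I, p < q) ∨ ∀ q ∈ I, q < p := by
    by_contra! h
    obtain ⟨⟨u, hu, hup⟩, v, hv, hpv⟩ := h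
    exact hpI (hI.out hu hv ⟨hup, hpv⟩)
  rcases hside with h | h
  · exact lt_irrefl p (lt_of_mem_spectrum_integral hm hC hsa (fun t q hq => h q (hmI t hq)) hp)
  · refine lt_irrefl (-p) (lt_of_mem_spectrum_integral hm.neg (C := C) (m := fun t => -m t)
      (fun t => by simpa using hC t) (fun t => (hsa t).neg) (fun t q hq => ?_) ?_)
    · rw [← spectrum.neg_eq] at hq
      linarith [h (-q) (hmI t hq)]
    · rw [integral_neg, ← spectrum.neg_eq]
      simpa using hp

/-! ### Measurability of the field of values of the functional calculus -/

theorem aestronglyMeasurable_jointCFC_of_isCompact {x : T → Fin n → B}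
    (hx : ∀ i, AEStronglyMeasurable (fun t => x t i) μ) (hsa : ∀ t i, IsSelfAdjoint (x t i))
    (hcomm : ∀ t i j, Commute (x t i) (x t j)) {K : Set (Fin n → ℝ)} (hK : IsCompact K)
    (hxK : ∀ t, spectrumBox (x t) ⊆ K) {f : (Fin n → ℝ) → ℝ} (hf : ContinuousOn f K) :
    AEStronglyMeasurable (fun t => jointCFC f (x t)) μ := by
  have : CompactSpace K := isCompact_iff_compactSpace.mp hK
  choose Ψ hΨ using fun t => exists_isRealCalculus (hsa t) (hcomm t) (hxK t)
  have key : ∀ g : C(K, ℝ), AEStronglyMeasurable (fun t => Ψ t g) μ := by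
    refine induction_on_realCoordinate (fun r => ?_) (fun i => ?_) (fun g h hg hh => ?_)
      (fun g h hg hh => ?_) ?_
    · simp only [AlgHom.commutes]
      exact aestronglyMeasurable_const
    · simpa only [(hΨ _).apply_coordinate] using hx i
    · simp only [map_add]; exact hg.add hh
    · simp only [map_mul]; exact hg.mul hh
    · refine IsSeqClosed.isClosed fun u g hu hug => ?_
      exact aestronglyMeasurable_of_tendsto_ae atTop hu
        (Eventually.of_forall fun t => ((hΨ t).continuous.tendsto g).comp hug)
  let F : C(K, ℝ) := ⟨fun p => f p, continuousOn_iff_continuous_domRestrict.mp hf⟩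
  simpa only [(hΨ _).jointCFC_eq f F fun _ => rfl] using key F

/-- If `f` is continuous on a product of intervals that contains the spectra of a bounded measurable
field of abelian tuples `x t`, then `f (x t)` is a measurable field. As `f` need not extend
continuously to a compact set that contains all the spectra, it is approximated by its compositions
with retractions onto compact boxes. -/
theorem aestronglyMeasurable_jointCFC {x : T → Fin n → B}
    (hx : ∀ i, AEStronglyMeasurable (fun t => x t i) μ) {C : ℝ} (hC : ∀ t i, ‖x t i‖ ≤ C)
    (hsa : ∀ t i, IsSelfAdjoint (x t i)) (hcomm : ∀ t i j, Commute (x t i) (x t j))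
    {I : Fin n → Set ℝ} (hI : ∀ i, (I i).OrdConnected) (hxI : ∀ t i, spectrum ℝ (x t i) ⊆ I i)
    {f : (Fin n → ℝ) → ℝ} (hf : ContinuousOn f (Set.univ.pi I)) :
    AEStronglyMeasurable (fun t => jointCFC f (x t)) μ := by
  rcases subsingleton_or_nontrivial B with hB | hB
  · have : (fun t => jointCFC f (x t)) = fun _ => 0 := funext fun t => Subsingleton.elim _ _
    rw [this]
    exact aestronglyMeasurable_const
  rcases isEmpty_or_nonempty T with hT | ⟨⟨t₀⟩⟩
  · have : (fun t => jointCFC f (x t)) = fun _ => 0 := funext fun t => hT.elim t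
    rw [this]
    exact aestronglyMeasurable_const
  have hne : ∀ i, (I i).Nonempty := fun i =>
    (ContinuousFunctionalCalculus.spectrum_nonempty (R := ℝ) (x t₀ i) (hsa t₀ i)).mono (hxI t₀ i)
  choose r hrc hrI hr using fun i => exists_retraction_seq (hI i) (hne i)
  let ρ : ℕ → (Fin n → ℝ) → Fin n → ℝ := fun k p i => r i k (p i)
  have hρ : ∀ k, Continuous fun p => f (ρ k p) := fun k =>
    hf.comp_continuous (continuous_pi fun i => (hrc i k).comp (continuous_apply i))
      fun p i _ => hrI i k (p i)
  have hbox : ∀ t, spectrumBox (x t) ⊆ Set.univ.pi fun _ => Set.Icc (-C) C := fun t p hp i hi =>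
    abs_le.mp ((abs_le_norm_of_mem_spectrum (hp i hi)).trans (hC t i))
  refine aestronglyMeasurable_of_tendsto_ae (f := fun k t => jointCFC (fun p => f (ρ k p)) (x t))
    atTop (fun k => aestronglyMeasurable_jointCFC_of_isCompact hx hsa hcomm
      (isCompact_univ_pi fun _ => isCompact_Icc) hbox (hρ k).continuousOn)
    (Eventually.of_forall fun t => tendsto_const_nhds.congr' ?_)
  have hev : ∀ᶠ k in atTop, ∀ i, ∀ p ∈ spectrum ℝ (x t i), r i k p = p :=
    eventually_all.mpr fun i => hr i _ (hxI t i) (spectrum.isCompact (x t i))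
  filter_upwards [hev] with k hk
  refine jointCFC_congr (hsa t) (hcomm t) (hf.mono fun p hp i hi => hxI t i (hp i hi))
    fun p hp => ?_
  exact congrArg f (funext fun i => (hk i _ (hp i trivial)).symm)

end RealCalculus

/-! ### Jensen's inequality for positive functionals on unital `C⋆`-algebras -/

section Jensen

variable {B : Type*} [CStarAlgebra B] {n : ℕ}

/-- The element `l(x) + c` for a linear form `l` on `ℝⁿ` and a constant `c`. -/
noncomputable def affineValue (l : (Fin n → ℝ) →L[ℝ] ℝ) (c : ℝ) (x : Fin n → B) : B :=
  ∑ i, l (Pi.single i 1) • x i + algebraMap ℝ B c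

theorem apply_eq_sum_single (l : (Fin n → ℝ) →L[ℝ] ℝ) (p : Fin n → ℝ) :
    l p = ∑ i, l (Pi.single i 1) * p i := by
  conv_lhs => rw [pi_eq_sum_univ' p]
  rw [map_sum]
  exact Finset.sum_congr rfl fun i _ => by rw [map_smul, smul_eq_mul, mul_comm]

theorem algebraMap_apply {K : Set (Fin n → ℝ)} (r : ℝ) (p : K) : algebraMap ℝ C(K, ℝ) r p = r := by
  simp [Algebra.algebraMap_eq_smul_one]

variable {x : Fin n → B} {K : Set (Fin n → ℝ)} [CompactSpace K] {Ψ : C(K, ℝ) →ₐ[ℝ] B}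

theorem IsRealCalculus.apply_affine (hΨ : IsRealCalculus x K Ψ) {l : (Fin n → ℝ) →L[ℝ] ℝ} {c : ℝ}
    {g : C(K, ℝ)} (hg : ∀ p : K, g p = l p + c) : Ψ g = affineValue l c x := by
  have h : g = ∑ i, l (Pi.single i 1) • realCoordinate K i + algebraMap ℝ C(K, ℝ) c := by
    ext p
    rw [hg, apply_eq_sum_single]
    simp [realCoordinate]
  rw [h, map_add, map_sum, AlgHom.commutes, affineValue]
  simp only [map_smul, hΨ.apply_coordinate]

/-- The square root of a nonnegative function gives the square root in the functional calculus. -/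
theorem exists_mul_self_eq (hΨ : IsRealCalculus x K Ψ) {g : C(K, ℝ)} (hg : ∀ p, 0 ≤ g p) :
    ∃ h : C(K, ℝ), g = h * h ∧ star (Ψ h) = Ψ h :=
  ⟨⟨fun p => √(g p), g.continuous.sqrt⟩, by ext p; exact (Real.mul_self_sqrt (hg p)).symm,
    hΨ.isSelfAdjoint _⟩

variable {ω : B →L[ℂ] ℂ}

theorem IsRealCalculus.map_nonneg (hΨ : IsRealCalculus x K Ψ) (hω : ∀ b, 0 ≤ ω (star b * b))
    {g : C(K, ℝ)} (hg : ∀ p, 0 ≤ g p) : 0 ≤ ω (Ψ g) := by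
  obtain ⟨h, rfl, hh⟩ := exists_mul_self_eq hΨ hg
  rw [map_mul]
  simpa only [hh] using hω (Ψ h)

theorem IsRealCalculus.map_im_eq_zero (hΨ : IsRealCalculus x K Ψ)
    (hω : ∀ b, 0 ≤ ω (star b * b)) (g : C(K, ℝ)) : (ω (Ψ g)).im = 0 := by
  have h1 := hΨ.map_nonneg hω (g := g + algebraMap ℝ C(K, ℝ) ‖g‖) fun p => by
    have := neg_le_of_abs_le (g.norm_coe_le_norm p)
    simp only [ContinuousMap.add_apply, algebraMap_apply]
    linarith
  have h2 := hΨ.map_nonneg hω (g := algebraMap ℝ C(K, ℝ) ‖g‖) fun p => by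
    rw [algebraMap_apply]
    exact norm_nonneg g
  rw [map_add, map_add] at h1
  have h3 := (Complex.nonneg_iff.mp h1).2
  rw [Complex.add_im, ← (Complex.nonneg_iff.mp h2).2, add_zero] at h3
  exact h3.symm

/-- If a functional is tracial against the entries of a tuple, it is so against the whole commutative
algebra that they generate. -/
theorem IsRealCalculus.map_mul_comm (hΨ : IsRealCalculus x K Ψ)
    (hx : ∀ i m, ω (x i * m) = ω (m * x i)) (g : C(K, ℝ)) (m : B) :
    ω (Ψ g * m) = ω (m * Ψ g) := by
  revert m
  refine induction_on_realCoordinate (P := fun g => ∀ m, ω (Ψ g * m) = ω (m * Ψ g))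
    (fun r m => ?_) (fun i m => ?_) (fun g h hg hh m => ?_) (fun g h hg hh m => ?_) ?_ g
  · rw [AlgHom.commutes, Algebra.commutes]
  · rw [hΨ.apply_coordinate, hx]
  · rw [map_add, add_mul, mul_add, map_add, map_add, hg, hh]
  · rw [map_mul Ψ, mul_assoc, hg, mul_assoc, hh, mul_assoc]
  · simp only [Set.ofPred_forall]
    exact isClosed_iInter fun m => isClosed_eq
      (ω.continuous.comp (hΨ.continuous.mul continuous_const))
      (ω.continuous.comp (continuous_const.mul hΨ.continuous))

/-- If a positive functional `ω` is tracial against the tuple `y`, then `ω(g(y) · )` is again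
a positive functional for nonnegative `g`, since it equals `ω(√g(y) · √g(y))`. -/
theorem IsRealCalculus.map_mul_nonneg {y : Fin n → B} {L : Set (Fin n → ℝ)} [CompactSpace L]
    {Θ : C(L, ℝ) →ₐ[ℝ] B} (hΘ : IsRealCalculus y L Θ) (hΨ : IsRealCalculus x K Ψ)
    (hω : ∀ b, 0 ≤ ω (star b * b)) (hy : ∀ i m, ω (y i * m) = ω (m * y i))
    {g : C(L, ℝ)} (hg : ∀ p, 0 ≤ g p) {k : C(K, ℝ)} (hk : ∀ p, 0 ≤ k p) :
    0 ≤ ω (Θ g * Ψ k) := by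
  obtain ⟨h, rfl, hh⟩ := exists_mul_self_eq hΘ hg
  obtain ⟨c, rfl, hc⟩ := exists_mul_self_eq hΨ hk
  have h1 := hω (Ψ c * Θ h)
  rw [star_mul, hh, hc] at h1
  rw [map_mul Θ, map_mul Ψ, mul_assoc, hΘ.map_mul_comm hy]
  simpa only [mul_assoc] using h1

variable {T : Type*} [MeasurableSpace T] {μ : Measure T}

theorem integrable_affineValue [IsFiniteMeasure μ] {x : T → Fin n → B}
    (hx : ∀ i, Integrable (fun t => x t i) μ) (l : (Fin n → ℝ) →L[ℝ] ℝ) (c : ℝ) :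
    Integrable (fun t => affineValue l c (x t)) μ :=
  (integrable_finsetSum _ fun i _ => (hx i).smul (l (Pi.single i 1))).add (integrable_const _)

theorem integral_affineValue [IsProbabilityMeasure μ] {x : T → Fin n → B}
    (hx : ∀ i, Integrable (fun t => x t i) μ) (l : (Fin n → ℝ) →L[ℝ] ℝ) (c : ℝ) :
    ∫ t, affineValue l c (x t) ∂μ = affineValue l c fun i => ∫ t, x t i ∂μ := by
  have h : ∀ i, Integrable (fun t => l (Pi.single i 1) • x t i) μ := fun i =>
    (hx i).smul (l (Pi.single i 1))
  unfold affineValue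
  rw [integral_add (integrable_finsetSum _ fun i _ => h i) (integrable_const _),
    integral_finsetSum _ fun i _ => h i]
  simp [integral_smul]

/-- Jensen's inequality for a positive functional that is tracial against the average of a field of
abelian tuples. -/
theorem jointCFC_integral_le [IsProbabilityMeasure μ] (hω : ∀ b, 0 ≤ ω (star b * b))
    {I : Fin n → Set ℝ} {f : (Fin n → ℝ) → ℝ} (hfconv : ConvexOn ℝ (Set.univ.pi I) f)
    (hfcont : ContinuousOn f (Set.univ.pi I)) {x : T → Fin n → B}
    (hx : ∀ i, Integrable (fun t => x t i) μ) (hsa : ∀ t i, IsSelfAdjoint (x t i))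
    (hcomm : ∀ t i j, Commute (x t i) (x t j)) (hxI : ∀ t i, spectrum ℝ (x t i) ⊆ I i)
    {y : Fin n → B} (hy : ∀ i, ∫ t, x t i ∂μ = y i) (hysa : ∀ i, IsSelfAdjoint (y i))
    (hycomm : ∀ i j, Commute (y i) (y j)) (hyI : ∀ i, spectrum ℝ (y i) ⊆ I i)
    (hyω : ∀ i m, ω (y i * m) = ω (m * y i))
    (hint : Integrable (fun t => ω (jointCFC f (x t))) μ) :
    ω (jointCFC f y) ≤ ∫ t, ω (jointCFC f (x t)) ∂μ := by
  have hxK : ∀ t, spectrumBox (x t) ⊆ Set.univ.pi I := fun t p hp i hi => hxI t i (hp i hi)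
  have hyK : spectrumBox y ⊆ Set.univ.pi I := fun p hp i hi => hyI i (hp i hi)
  obtain ⟨Θ, hΘ⟩ := exists_isRealCalculus hysa hycomm subset_rfl
  choose Ψ hΨ using fun t => exists_isRealCalculus (hsa t) (hcomm t) subset_rfl
  let F : C(spectrumBox y, ℝ) :=
    ⟨fun p => f p, continuousOn_iff_continuous_domRestrict.mp (hfcont.mono hyK)⟩
  let G : ∀ t, C(spectrumBox (x t), ℝ) := fun t =>
    ⟨fun p => f p, continuousOn_iff_continuous_domRestrict.mp (hfcont.mono (hxK t))⟩
  have hF : jointCFC f y = Θ F := hΘ.jointCFC_eq f F fun _ => rfl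
  have hG : ∀ t, jointCFC f (x t) = Ψ t (G t) := fun t => (hΨ t).jointCFC_eq f (G t) fun _ => rfl
  have hG0 : ∀ t, (ω (jointCFC f (x t))).im = 0 := fun t => by
    rw [hG]; exact (hΨ t).map_im_eq_zero hω _
  have hre : (∫ t, ω (jointCFC f (x t)) ∂μ).re = ∫ t, (ω (jointCFC f (x t))).re ∂μ :=
    (Complex.reCLM.integral_comp_comm hint).symm
  have him : (∫ t, ω (jointCFC f (x t)) ∂μ).im = ∫ t, (ω (jointCFC f (x t))).im ∂μ :=
    (Complex.imCLM.integral_comp_comm hint).symm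
  refine Complex.le_def.mpr ⟨?_, ?_⟩
  swap
  · rw [him, hF, hΘ.map_im_eq_zero hω]
    simp [hG0]
  rw [hre]
  have hω1 : 0 ≤ (ω 1).re := by
    have := (Complex.nonneg_iff.mp (hω 1)).1
    simpa using this
  refine le_of_forall_pos_le_add fun δ hδ => ?_
  let ε := δ / (2 * ((ω 1).re + 1))
  have hε : 0 < ε := by positivity
  have hεδ : 2 * ε * (ω 1).re ≤ δ := by
    have h : 2 * ε * ((ω 1).re + 1) = δ := by
      simp only [ε]; field_simp
    nlinarith
  obtain ⟨J, l, c, g, hl, hg0, hg1, hgl⟩ :=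
    exists_partition_affine_le hfconv hfcont (isCompact_spectrumBox y) hyK hε
  have hΘ1 : ∑ j ∈ J, Θ (g j) = 1 := by
    rw [← map_sum, ← map_one Θ]
    congr 1
    ext p
    simpa using hg1 p
  -- the functional `Re ω(g_j(y) · )`, which commutes with integration
  let Λ : (Fin n → ℝ) → B →L[ℝ] ℝ := fun j =>
    (Complex.reCLM.comp (ω.restrictScalars ℝ)).comp (ContinuousLinearMap.mul ℝ B (Θ (g j)))
  have hΛ : ∀ j b, Λ j b = (ω (Θ (g j) * b)).re := fun _ _ => rfl
  have hΛsum : ∀ b, ∑ j ∈ J, Λ j b = (ω b).re := by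
    intro b
    simp only [hΛ]
    rw [← Complex.re_sum, ← map_sum, ← Finset.sum_mul, hΘ1, one_mul]
  have hmeas : ∀ j, Integrable (fun t => Λ j (affineValue (l j) (c j) (x t))) μ := fun j =>
    (Λ j).integrable_comp (integrable_affineValue hx _ _)
  have hsub : ∀ t, ∑ j ∈ J, Λ j (affineValue (l j) (c j) (x t)) ≤ (ω (jointCFC f (x t))).re := by
    intro t
    rw [← hΛsum]
    refine Finset.sum_le_sum fun j hj => sub_nonneg.mp ?_
    let a : C(spectrumBox (x t), ℝ) :=
      ⟨fun p => l j p + c j, ((l j).continuous.comp continuous_subtype_val).add continuous_const⟩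
    rw [← map_sub, hG, ← (hΨ t).apply_affine (g := a) fun _ => rfl, ← map_sub, hΛ]
    exact (Complex.nonneg_iff.mp (hΘ.map_mul_nonneg (hΨ t) hω hyω (hg0 j)
      fun p => sub_nonneg.mpr (hl j hj p (hxK t p.2)))).1
  have hmain : (ω (jointCFC f y)).re - 2 * ε * (ω 1).re ≤
      ∑ j ∈ J, Λ j (affineValue (l j) (c j) y) := by
    let a : (Fin n → ℝ) → C(spectrumBox y, ℝ) := fun j =>
      ⟨fun p => l j p + c j, ((l j).continuous.comp continuous_subtype_val).add continuous_const⟩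
    have h := hΘ.map_nonneg hω
      (g := ∑ j ∈ J, g j * a j - F + algebraMap ℝ _ (2 * ε)) fun p => by
        have := hgl p
        simp only [ContinuousMap.add_apply, ContinuousMap.sub_apply, ContinuousMap.sum_apply,
          ContinuousMap.mul_apply, algebraMap_apply]
        change 0 ≤ ∑ j ∈ J, g j p * (l j p + c j) - f p + 2 * ε
        linarith
    have h1 := (Complex.nonneg_iff.mp h).1
    rw [map_add, map_sub, map_sum, AlgHom.commutes, Algebra.algebraMap_eq_smul_one, ← hF,
      map_add, map_sub, map_sum, ← Complex.coe_smul, map_smul, Complex.add_re, Complex.sub_re,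
      Complex.re_sum, smul_eq_mul, Complex.re_ofReal_mul] at h1
    have h2 : ∀ j, (ω (Θ (g j * a j))).re = Λ j (affineValue (l j) (c j) y) := fun j => by
      rw [hΛ, map_mul, hΘ.apply_affine (g := a j) fun _ => rfl]
    simp only [h2] at h1
    linarith
  have hy' : ∀ j, ∫ t, Λ j (affineValue (l j) (c j) (x t)) ∂μ =
      Λ j (affineValue (l j) (c j) y) := fun j => by
    rw [(Λ j).integral_comp_comm (integrable_affineValue hx _ _), integral_affineValue hx,
      funext hy]
  have hle : ∑ j ∈ J, Λ j (affineValue (l j) (c j) y) ≤ ∫ t, (ω (jointCFC f (x t))).re ∂μ := by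
    calc _ = ∫ t, ∑ j ∈ J, Λ j (affineValue (l j) (c j) (x t)) ∂μ := by
          rw [integral_finsetSum _ fun j _ => hmeas j]
          exact Finset.sum_congr rfl fun j _ => (hy' j).symm
      _ ≤ _ := integral_mono (integrable_finsetSum _ fun j _ => hmeas j) hint.re hsub
  linarith

end Jensen

/-! ### Extension of functionals to the multiplier algebra -/

section Extension

variable {A : Type*} [NonUnitalCStarAlgebra A]

theorem fst_mul (m : 𝓜(ℂ, A)) (a b : A) : m.fst (a * b) = m.fst a * b := by
  have h : ∀ c, c * (m.fst (a * b) - m.fst a * b) = 0 := fun c => by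
    rw [mul_sub, ← m.central, ← mul_assoc, ← mul_assoc, ← m.central, sub_self]
  exact sub_eq_zero.mp (CStarRing.star_mul_self_eq_zero_iff _ |>.mp (h _))

variable [PartialOrder A] [StarOrderedRing A]

/-- The canonical extension of a bounded functional to the multiplier algebra, as a bounded
functional. -/
noncomputable def extendCLM (ψ : A →L[ℂ] ℂ) : 𝓜(ℂ, A) →L[ℂ] ℂ :=
  LinearMap.mkContinuous
    { toFun := extend (ψ : A →ₗ[ℂ] ℂ)
      map_add' := fun m k => tendsto_nhds_unique (tendsto_extend ψ (m + k))
        (((tendsto_extend ψ m).add (tendsto_extend ψ k)).congr fun e => (map_add ψ _ _).symm)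
      map_smul' := fun c m => tendsto_nhds_unique (tendsto_extend ψ (c • m))
        (((tendsto_extend ψ m).const_smul c).congr fun e => (map_smul ψ _ _).symm) }
    ‖ψ‖ fun m => by
      refine le_of_tendsto (tendsto_extend ψ m).norm ?_
      filter_upwards [(CStarAlgebra.increasingApproximateUnit A).eventually_norm] with e he
      refine (ψ.le_opNorm _).trans (mul_le_mul_of_nonneg_left ?_ (norm_nonneg ψ))
      refine (m.fst.le_opNorm e).trans ?_
      rw [DoubleCentralizer.norm_fst]
      exact mul_le_of_le_one_right (norm_nonneg m) he

/-- A Bochner integral in the multiplier algebra is an integral in the weak sense. -/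
theorem hasWeakIntegral_integral {T : Type*} [MeasurableSpace T] {μ : Measure T}
    {m : T → 𝓜(ℂ, A)} (hm : Integrable m μ) : HasWeakIntegral m μ (∫ t, m t ∂μ) :=
  fun ψ => ⟨(extendCLM ψ).integrable_comp hm, (extendCLM ψ).integral_comp_comm hm⟩

/-- A positive functional as a bounded functional. -/
noncomputable def positiveCLM (φ : A →ₚ[ℂ] ℂ) : A →L[ℂ] ℂ :=
  ⟨φ.toLinearMap, map_continuous φ⟩

theorem norm_sq_apply_star_mul_le (φ : A →ₚ[ℂ] ℂ) (a b : A) :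
    ‖φ (star a * b)‖ ^ 2 ≤ (φ (star a * a)).re * (φ (star b * b)).re := by
  have h := norm_inner_le_norm (𝕜 := ℂ) (φ.toPreGNS a) (φ.toPreGNS b)
  have hn : ∀ c : A, ‖φ.toPreGNS c‖ ^ 2 = (φ (star c * c)).re := fun c => by
    have := congrArg Complex.re (φ.preGNS_norm_sq (φ.toPreGNS c))
    rwa [← Complex.ofReal_pow, Complex.ofReal_re] at this
  rw [← hn, ← hn, ← mul_pow]
  exact pow_le_pow_left₀ (norm_nonneg _) h 2

theorem mul_self_le_of_norm_le_one {a : A} (ha : 0 ≤ a) (h1 : ‖a‖ ≤ 1) : a * a ≤ a := by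
  have hs : star (CFC.sqrt a) = CFC.sqrt a := (IsSelfAdjoint.of_nonneg (CFC.sqrt_nonneg a)).star_eq
  have hss : CFC.sqrt a * CFC.sqrt a = a := CFC.sqrt_mul_sqrt_self a ha
  have h := CStarAlgebra.star_left_conjugate_le_norm_smul (a := CFC.sqrt a) (b := a)
    (hb := IsSelfAdjoint.of_nonneg ha)
  rw [hs, hss] at h
  have h2 : CFC.sqrt a * a * CFC.sqrt a = a * a := by
    nth_rewrite 2 [← hss]
    rw [← mul_assoc, hss, mul_assoc, hss]
  rw [h2] at h
  exact h.trans (smul_le_of_le_one_left ha h1)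

/-- By the Cauchy–Schwarz inequality, compressing `m d` to `d m d` changes the value of a positive
functional `φ` by an amount controlled by the distance of `φ(d)` from its limit. -/
theorem norm_sq_sub_le_of_norm_lt_one (φ : A →ₚ[ℂ] ℂ) (m : 𝓜(ℂ, A)) {d : A} (hd0 : 0 ≤ d)
    (hd1 : ‖d‖ < 1) : ‖φ (m.fst d) - φ (d * m.fst d)‖ ^ 2 ≤
      (extend φ.toLinearMap (1 : 𝓜(ℂ, A)) - φ d).re * (‖positiveCLM φ‖ * ‖m‖ ^ 2) := by
  have hφ : Continuous φ := map_continuous φ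
  have hunit := CStarAlgebra.increasingApproximateUnit A
  have h1 : Tendsto (fun e => φ e) (CStarAlgebra.approximateUnit A)
      (𝓝 (extend φ.toLinearMap (1 : 𝓜(ℂ, A)))) := tendsto_extend (positiveCLM φ) 1
  have h2 : Tendsto (fun e => φ (e * m.fst d)) (CStarAlgebra.approximateUnit A)
      (𝓝 (φ (m.fst d))) := (hφ.tendsto _).comp (hunit.tendsto_mul_right _)
  refine le_of_tendsto_of_tendsto ((h2.sub_const (φ (d * m.fst d))).norm.pow 2)
    ((Complex.continuous_re.tendsto _).comp (h1.sub_const (φ d)) |>.mul_const _) ?_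
  filter_upwards [(CStarAlgebra.hasBasis_approximateUnit A).mem_of_mem ⟨hd0, hd1⟩] with e he
  have hed : 0 ≤ e - d := sub_nonneg.mpr he.1
  have hle : e - d ≤ e := sub_le_self e hd0
  have hnorm : ‖e - d‖ ≤ 1 := (CStarAlgebra.norm_le_norm_of_nonneg_of_le hed hle).trans
    (mem_closedBall_zero_iff.mp he.2)
  have hcs := norm_sq_apply_star_mul_le φ (e - d) (m.fst d)
  rw [(IsSelfAdjoint.of_nonneg hed).star_eq, sub_mul, map_sub] at hcs
  refine hcs.trans (mul_le_mul ?_ ?_ ?_ ?_)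
  · have h := OrderHomClass.mono φ (mul_self_le_of_norm_le_one hed hnorm)
    simpa using (Complex.le_def.mp h).1
  · refine (Complex.re_le_norm _).trans (((positiveCLM φ).le_opNorm _).trans
      (mul_le_mul_of_nonneg_left ?_ (norm_nonneg _)))
    rw [CStarRing.norm_star_mul_self, ← sq]
    refine pow_le_pow_left₀ (norm_nonneg _) ((m.fst.le_opNorm d).trans ?_) 2
    rw [DoubleCentralizer.norm_fst]
    exact mul_le_of_le_one_right (norm_nonneg m) hd1.le
  · exact (Complex.nonneg_iff.mp (φ.map_nonneg (star_mul_self_nonneg _))).1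
  · simpa using (Complex.nonneg_iff.mp (φ.map_nonneg hed)).1

/-- The extension of a positive functional to the multiplier algebra can be computed by two-sided
compression with the approximate unit. -/
theorem tendsto_mul_fst_extend (φ : A →ₚ[ℂ] ℂ) (m : 𝓜(ℂ, A)) :
    Tendsto (fun e => φ (e * m.fst e)) (CStarAlgebra.approximateUnit A)
      (𝓝 (extend φ.toLinearMap m)) := by
  have hφ : Continuous φ := map_continuous φ
  have hunit := CStarAlgebra.increasingApproximateUnit A
  have hm : Tendsto (fun e => φ (m.fst e)) (CStarAlgebra.approximateUnit A)
      (𝓝 (extend φ.toLinearMap m)) := tendsto_extend (positiveCLM φ) m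
  have h1 : Tendsto (fun e => φ e) (CStarAlgebra.approximateUnit A)
      (𝓝 (extend φ.toLinearMap (1 : 𝓜(ℂ, A)))) := tendsto_extend (positiveCLM φ) 1
  have hclosed : IsClosed {d | ‖φ (m.fst d) - φ (d * m.fst d)‖ ^ 2 ≤
      (extend φ.toLinearMap (1 : 𝓜(ℂ, A)) - φ d).re * (‖positiveCLM φ‖ * ‖m‖ ^ 2)} := by
    have hmc := m.fst.continuous
    exact isClosed_le (((hφ.comp hmc).sub (hφ.comp (continuous_id.mul hmc))).norm.pow 2)
      ((Complex.continuous_re.comp (continuous_const.sub hφ)).mul continuous_const)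
  have hsq : Tendsto (fun d => ‖φ (m.fst d) - φ (d * m.fst d)‖ ^ 2)
      (CStarAlgebra.approximateUnit A) (𝓝 0) := by
    have hlim : Tendsto (fun d => (extend φ.toLinearMap (1 : 𝓜(ℂ, A)) - φ d).re *
        (‖positiveCLM φ‖ * ‖m‖ ^ 2)) (CStarAlgebra.approximateUnit A) (𝓝 0) := by
      have h := ((Complex.continuous_re.tendsto _).comp
        (h1.const_sub (extend φ.toLinearMap (1 : 𝓜(ℂ, A))))).mul_const (‖positiveCLM φ‖ * ‖m‖ ^ 2)
      rw [sub_self, Complex.zero_re, zero_mul] at h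
      exact h
    refine tendsto_of_tendsto_of_tendsto_of_le_of_le' tendsto_const_nhds hlim
      (Eventually.of_forall fun _ => sq_nonneg _) ?_
    filter_upwards [hunit.eventually_nonneg, hunit.eventually_norm] with d hd0 hd1
    -- The approximate unit contains elements of norm one, which are limits of `s • d` for `s < 1`.
    have hs : Tendsto (fun s : ℝ => s • d) (𝓝[<] 1) (𝓝 d) :=
      ((by fun_prop : Continuous fun s : ℝ => s • d).tendsto' 1 d (one_smul ℝ d)).mono_left
        nhdsWithin_le_nhds
    refine hclosed.mem_of_tendsto hs ?_
    filter_upwards [Ioo_mem_nhdsLT (zero_lt_one (α := ℝ))] with s hs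
    refine norm_sq_sub_le_of_norm_lt_one φ m (smul_nonneg hs.1.le hd0) ?_
    rw [norm_smul, Real.norm_of_nonneg hs.1.le]
    exact (mul_le_of_le_one_right hs.1.le hd1).trans_lt hs.2
  have h0 : Tendsto (fun d => φ (m.fst d) - φ (d * m.fst d)) (CStarAlgebra.approximateUnit A)
      (𝓝 0) := by
    rw [tendsto_zero_iff_norm_tendsto_zero]
    simpa using hsq.sqrt
  simpa using hm.sub h0

theorem extend_star_mul_self_nonneg (φ : A →ₚ[ℂ] ℂ) (b : 𝓜(ℂ, A)) :
    0 ≤ extend φ.toLinearMap (star b * b) := by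
  refine ge_of_tendsto (tendsto_mul_fst_extend φ (star b * b)) ?_
  filter_upwards [(CStarAlgebra.increasingApproximateUnit A).eventually_star_eq] with e he
  have h : e * (star b * b).fst e = star (b.fst e) * b.fst e := by
    change e * (star b).fst (b.fst e) = _
    rw [← (star b).central, DoubleCentralizer.star_snd, he]
  rw [h]
  exact φ.map_nonneg (star_mul_self_nonneg _)

/-- An element of the centralizer of a positive functional is in the centralizer of its extension to
the multiplier algebra. -/
theorem extend_mul_comm_of_mem_centralizer {φ : A →ₚ[ℂ] ℂ} {y : A} (hy : y ∈ centralizer φ)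
    (m : 𝓜(ℂ, A)) : extend φ.toLinearMap ((y : 𝓜(ℂ, A)) * m) =
      extend φ.toLinearMap (m * (y : 𝓜(ℂ, A))) := by
  have hunit := CStarAlgebra.increasingApproximateUnit A
  have hφ : Continuous φ := map_continuous φ
  have h1 := tendsto_extend (positiveCLM φ) ((y : 𝓜(ℂ, A)) * m)
  have h2 := tendsto_extend (positiveCLM φ) (m * (y : 𝓜(ℂ, A)))
  have h3 : Tendsto (fun e => φ (m.fst (e * y))) (CStarAlgebra.approximateUnit A)
      (𝓝 (φ (m.fst y))) :=
    ((hφ.comp m.fst.continuous).tendsto y).comp (hunit.tendsto_mul_right y)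
  have h4 : Tendsto (fun e => φ (m.fst (y * e))) (CStarAlgebra.approximateUnit A)
      (𝓝 (φ (m.fst y))) :=
    ((hφ.comp m.fst.continuous).tendsto y).comp (hunit.tendsto_mul_left y)
  refine (tendsto_nhds_unique h1 (h3.congr fun e => ?_)).trans
    (tendsto_nhds_unique h4 h2)
  rw [fst_mul]
  exact hy (m.fst e)

end Extension

/-! ### Fields in the multiplier algebra -/

section Fields

variable {A : Type*} [NonUnitalCStarAlgebra A]

/-- The embedding of `A` in its multiplier algebra as a bounded linear map. -/
noncomputable def coeCLM : A →L[ℂ] 𝓜(ℂ, A) :=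
  LinearMap.mkContinuous
    { toFun := fun a => (a : 𝓜(ℂ, A))
      map_add' := map_add (DoubleCentralizer.coeHom (𝕜 := ℂ) (A := A))
      map_smul' := map_smul (DoubleCentralizer.coeHom (𝕜 := ℂ) (A := A)) } 1
    fun a => by
      rw [one_mul]
      exact NonUnitalStarAlgHom.norm_apply_le (DoubleCentralizer.coeHom (𝕜 := ℂ) (A := A)) a

theorem isSelfAdjoint_coe {a : A} (ha : IsSelfAdjoint a) : IsSelfAdjoint (a : 𝓜(ℂ, A)) :=
  ha.map (DoubleCentralizer.coeHom (𝕜 := ℂ) (A := A))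

theorem commute_coe {a b : A} (h : Commute a b) : Commute (a : 𝓜(ℂ, A)) (b : 𝓜(ℂ, A)) :=
  h.map (DoubleCentralizer.coeHom (𝕜 := ℂ) (A := A))

/-- The Bochner integral of a field of self-adjoint elements is self-adjoint. -/
theorem isSelfAdjoint_integral {T : Type*} [MeasurableSpace T] {μ : Measure T} {x : T → A}
    (hsa : ∀ t, IsSelfAdjoint (x t)) : IsSelfAdjoint (∫ t, x t ∂μ) := by
  have h := ((starL' ℝ : A ≃L[ℝ] A)).integral_comp_comm (μ := μ) x
  have h1 : ∀ t, (starL' ℝ : A ≃L[ℝ] A) (x t) = x t := fun t => (hsa t).star_eq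
  simp only [h1] at h
  exact h.symm

/-- If the commutator of `x t` and `y s` is symmetric in `s` and `t`, up to exchanging `x` and `y`,
then averaging over both parameters shows that the commutator of the two averages equals its own
negative. -/
theorem commute_integral {T : Type*} [MeasurableSpace T] {μ : Measure T} {x y : T → A}
    (hx : Integrable x μ) (hy : Integrable y μ)
    (h : ∀ s t, x t * y s - y s * x t = y t * x s - x s * y t) :
    Commute (∫ t, x t ∂μ) (∫ t, y t ∂μ) := by
  -- integration of the commutator in the first variable
  have key : ∀ {z : T → A}, Integrable z μ → ∀ a : A,
      ∫ t, (z t * a - a * z t) ∂μ = (∫ t, z t ∂μ) * a - a * ∫ t, z t ∂μ := by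
    intro z hz a
    exact (((ContinuousLinearMap.mul ℝ A).flip a) -
      (ContinuousLinearMap.mul ℝ A a)).integral_comp_comm hz
  have h1 : ∀ s, (∫ t, x t ∂μ) * y s - y s * (∫ t, x t ∂μ) =
      (∫ t, y t ∂μ) * x s - x s * ∫ t, y t ∂μ := fun s => by
    rw [← key hx, ← key hy]
    simp only [h s]
  have h2 := key hy (∫ t, x t ∂μ)
  have h3 := key hx (∫ t, y t ∂μ)
  have h4 : ∫ s, (y s * (∫ t, x t ∂μ) - (∫ t, x t ∂μ) * y s) ∂μ =
      ∫ s, (x s * (∫ t, y t ∂μ) - (∫ t, y t ∂μ) * x s) ∂μ := by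
    congr 1
    funext s
    rw [← neg_sub, h1, neg_sub]
  rw [h2, h3] at h4
  have h5 : (2 : ℝ) • ((∫ t, x t ∂μ) * (∫ t, y t ∂μ) - (∫ t, y t ∂μ) * ∫ t, x t ∂μ) = 0 := by
    rw [two_smul]
    nth_rewrite 1 [← h4]
    abel
  exact sub_eq_zero.mp ((smul_eq_zero.mp h5).resolve_left two_ne_zero)

end Fields

end JensenTrace

theorem corollary10 {A : Type*} [NonUnitalCStarAlgebra A] [PartialOrder A] [StarOrderedRing A]
    [TopologicalSpace.SeparableSpace A]
    {T : Type*} [MetricSpace T] [LocallyCompactSpace T] [MeasurableSpace T] [BorelSpace T]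
    (μ : Measure T) [IsProbabilityMeasure μ]
    (n : ℕ) (I : Fin n → Set ℝ) (hI : ∀ i, (I i).OrdConnected)
    (f : (Fin n → ℝ) → ℝ) (hfconv : ConvexOn ℝ (Set.univ.pi I) f)
    (hfcont : ContinuousOn f (Set.univ.pi I))
    (x : Fin n → T → A)
    (hxmeas : ∀ i, JensenTrace.WeakStarMeasurable (fun t => (x i t : 𝓜(ℂ, A))) μ)
    (hxbdd : ∀ i, ∃ C : ℝ, ∀ t, ‖x i t‖ ≤ C)
    (hxsa : ∀ i t, IsSelfAdjoint (x i t))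
    (hxsp : ∀ i t, spectrum ℝ (x i t : 𝓜(ℂ, A)) ⊆ I i)
    (hxcomm : ∀ i j s t, x i t * x j s - x j s * x i t = x j t * x i s - x i s * x j t) :
    -- the integrals `y i = ∫ x i t dμ(t)` exist in `A`
    ∃ y : Fin n → A,
      (∀ i, JensenTrace.HasWeakIntegral (fun t => (x i t : 𝓜(ℂ, A))) μ (y i : 𝓜(ℂ, A))) ∧
      -- they form an abelian tuple in the domain of `f`
      (∀ i, IsSelfAdjoint (y i)) ∧ (∀ i, spectrum ℝ (y i : 𝓜(ℂ, A)) ⊆ I i) ∧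
      (∀ i j, Commute (y i) (y j)) ∧
      -- the field `f(x_t)` is weak* measurable, and it is integrable if the intervals are closed
      -- or its norm is integrable
      JensenTrace.WeakStarMeasurable
        (fun t => JensenTrace.jointCFC f fun i => (x i t : 𝓜(ℂ, A))) μ ∧
      ((∀ i, IsClosed (I i)) ∨
          Integrable (fun t => ‖JensenTrace.jointCFC f fun i => (x i t : 𝓜(ℂ, A))‖) μ →
        ∃ z, JensenTrace.HasWeakIntegral
          (fun t => JensenTrace.jointCFC f fun i => (x i t : 𝓜(ℂ, A))) μ z) ∧
      -- the inequality `φ(f(y)) ≤ φ(∫ f(x_t) dμ(t))`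
      ∀ φ : A →ₚ[ℂ] ℂ, (∀ i, y i ∈ JensenTrace.centralizer φ) →
        ∀ z, JensenTrace.HasWeakIntegral
            (fun t => JensenTrace.jointCFC f fun i => (x i t : 𝓜(ℂ, A))) μ z →
          JensenTrace.extend φ.toLinearMap (JensenTrace.jointCFC f fun i => (y i : 𝓜(ℂ, A))) ≤
            JensenTrace.extend φ.toLinearMap z := by
  choose C hC using hxbdd
  obtain ⟨R, hR⟩ : ∃ R, ∀ t i, ‖x i t‖ ≤ R :=
    ⟨∑ i, |C i|, fun t i => (hC i t).trans ((le_abs_self _).trans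
      (Finset.single_le_sum (fun i _ => abs_nonneg (C i)) (Finset.mem_univ i)))⟩
  have hmeas : ∀ i, AEStronglyMeasurable (x i) μ := fun i =>
    JensenTrace.aestronglyMeasurable_of_forall_dual (𝕜 := ℂ) fun ψ =>
      (hxmeas i ψ).congr (Eventually.of_forall fun t => JensenTrace.extend_coe ψ (x i t))
  have hint : ∀ i, Integrable (x i) μ := fun i =>
    Integrable.of_bound (hmeas i) R (Eventually.of_forall fun t => hR t i)
  let X : T → Fin n → 𝓜(ℂ, A) := fun t i => (x i t : 𝓜(ℂ, A))
  have hX : ∀ i, Integrable (fun t => X t i) μ := fun i =>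
    JensenTrace.coeCLM.integrable_comp (hint i)
  have hXR : ∀ t i, ‖X t i‖ ≤ R := fun t i =>
    (NonUnitalStarAlgHom.norm_apply_le (DoubleCentralizer.coeHom (𝕜 := ℂ) (A := A)) _).trans
      (hR t i)
  have hXsa : ∀ t i, IsSelfAdjoint (X t i) := fun t i => JensenTrace.isSelfAdjoint_coe (hxsa i t)
  have hXcomm : ∀ t i j, Commute (X t i) (X t j) := fun t i j => by
    refine JensenTrace.commute_coe ?_
    have h := hxcomm i j t t
    have h1 : (2 : ℝ) • (x i t * x j t - x j t * x i t) = 0 := by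
      rw [two_smul]
      nth_rewrite 1 [h]
      abel
    exact sub_eq_zero.mp ((smul_eq_zero.mp h1).resolve_left two_ne_zero)
  have hXI : ∀ t i, spectrum ℝ (X t i) ⊆ I i := fun t i => hxsp i t
  have hXy : ∀ i, ∫ t, X t i ∂μ = ((∫ t, x i t ∂μ : A) : 𝓜(ℂ, A)) := fun i =>
    JensenTrace.coeCLM.integral_comp_comm (hint i)
  have hysa : ∀ i, IsSelfAdjoint (∫ t, x i t ∂μ) := fun i =>
    JensenTrace.isSelfAdjoint_integral (hxsa i)
  have hyI : ∀ i, spectrum ℝ ((∫ t, x i t ∂μ : A) : 𝓜(ℂ, A)) ⊆ I i := fun i => by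
    rw [← hXy]
    exact JensenTrace.spectrum_integral_subset (hX i) (fun t => hXR t i) (fun t => hXsa t i)
      (hI i) fun t => hXI t i
  have hycomm : ∀ i j, Commute (∫ t, x i t ∂μ) (∫ t, x j t ∂μ) := fun i j =>
    JensenTrace.commute_integral (hint i) (hint j) fun s t => hxcomm i j s t
  have hfX : AEStronglyMeasurable (fun t => JensenTrace.jointCFC f (X t)) μ :=
    JensenTrace.aestronglyMeasurable_jointCFC (fun i => (hX i).aestronglyMeasurable) hXR hXsa
      hXcomm hI hXI hfcont
  refine ⟨fun i => ∫ t, x i t ∂μ, fun i => ?_, hysa, hyI, hycomm, fun ψ => ?_, fun h => ?_,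
    fun φ hφ z hz => ?_⟩
  · rw [← hXy]
    exact JensenTrace.hasWeakIntegral_integral (hX i)
  · exact (JensenTrace.extendCLM ψ).continuous.comp_aestronglyMeasurable hfX
  · refine ⟨_, JensenTrace.hasWeakIntegral_integral ?_⟩
    rcases h with hclosed | hnorm
    · -- If the intervals are closed, all spectra lie in one compact box on which `f` is bounded.
      let K : Set (Fin n → ℝ) := Set.univ.pi fun i => I i ∩ Set.Icc (-R) R
      have hK : IsCompact K := isCompact_univ_pi fun i => isCompact_Icc.inter_left (hclosed i)
      have hXK : ∀ t, JensenTrace.spectrumBox (X t) ⊆ K := fun t p hp i hi =>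
        ⟨hXI t i (hp i hi), abs_le.mp
          ((JensenTrace.abs_le_norm_of_mem_spectrum (hp i hi)).trans (hXR t i))⟩
      have hKI : K ⊆ Set.univ.pi I := fun p hp i hi => (hp i hi).1
      obtain ⟨M, hM⟩ := hK.exists_bound_of_continuousOn (hfcont.mono hKI)
      refine Integrable.of_bound hfX (max M 0) (Eventually.of_forall fun t => ?_)
      exact JensenTrace.norm_jointCFC_le (hXsa t) (hXcomm t) (hfcont.mono ((hXK t).trans hKI))
        (le_max_right _ _) fun p hp => (hM p (hXK t hp)).trans (le_max_left _ _)
    · exact (integrable_norm_iff hfX).mp hnorm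
  · obtain ⟨hz1, hz2⟩ := hz (JensenTrace.positiveCLM φ)
    have h := JensenTrace.jointCFC_integral_le (μ := μ) (x := X)
      (ω := JensenTrace.extendCLM (JensenTrace.positiveCLM φ))
      (JensenTrace.extend_star_mul_self_nonneg φ) hfconv hfcont hX hXsa hXcomm hXI hXy
      (fun i => JensenTrace.isSelfAdjoint_coe (hysa i))
      (fun i j => JensenTrace.commute_coe (hycomm i j)) hyI
      (fun i m => JensenTrace.extend_mul_comm_of_mem_centralizer (hφ i) m) hz1
    exact h.trans_eq hz2
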